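/- Let $X$ and $Z$ be real Banach spaces. For a Lipschitz map $f$ on a set $S\subset X$ write $\operatorname{Lip}(f)$ for its least Lipschitz constant on $S$ (and $0$ if $S=\emptyset$). Assume that $(X,Z)$ has property (*) with a constant $C_0>0$: for every $S\subset X$, every Lipschitz $\varphi:S\to Z$ and every $\eta>0$ there is a $C^1$ smooth Lipschitz map $\psi:X\to Z$ with $\|\varphi(x)-\psi(x)\|<\eta$ for all $x\in S$ and $\operatorname{Lip}(\psi)\le C_0\operatorname{Lip}(\varphi)$. Assume also that $(X,Z)$ has property (E) with a constant $K>0$: for every $S\subset X$, every Lipschitz $\varphi:S\to Z$ has a Lipschitz extension $\Phi:X\to Z$ with $\operatorname{Lip}(\Phi)\le K\operatorname{Lip}(\varphi)$. Let $A\subset X$ be closed, $R\in(0,\infty]$, and let $f:A\to Z$ be Lipschitz with $\|f(y)\|\le R$ for all $y\in A$ (no condition if $R=\infty$). Let $D:A\to\mathcal L(X,Z)$ be continuous with $\|D(y)\|\le M$ for all $y\in A$, where $0\le M<\infty$, and suppose that $f$ satisfies the mean value condition for $D$: for every $y\in A$ and every $\eta>0$ there is $r>0$ such that $\|f(z)-f(w)-D(y)(z-w)\|\le\eta\|z-w\|$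 for all $z,w\in A\cap B(y,r)$. Let $\tau>2$ and $\varepsilon,\varepsilon'>0$ with $3\varepsilon'<\varepsilon$, and put $\delta=\frac{2}{\tau-2}$, $L_2=\frac{\varepsilon'}{C_0}+\operatorname{Lip}(f)$, $$L_3=\max\Big\{2\delta\Big(\frac{\varepsilon'}{8C_0}+\varepsilon'+M\Big)+L_2(2\delta+1),\ \frac{\varepsilon'}{8C_0}+\varepsilon'+M\Big\},$$ $$L_4=\frac{\varepsilon'}{4}+C_0KL_3,\qquad Q_1=(K+1)\Big(R+\varepsilon'+\frac{\varepsilon'}{8C_0}\Big)+\frac{\varepsilon'}{8}.$$ Then there is a $C^1$ smooth map $g:X\to Z$ such that (i) $\|f(y)-g(y)\|<\varepsilon$ for all $y\in A$; (ii) $\|D(y)-g'(y)\|<\varepsilon$ for all $y\in A$; (iii) $f-g|_A$ is Lipschitz and $\operatorname{Lip}(f-g|_A)<\varepsilon$; (iv) if $R<\infty$, then $\|g(x)\|\le Q_1$ for all $x\in X$; (v) $g$ is Lipschitz and $\operatorname{Lip}(g)\le L_4$. -/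

import Mathlib

open scoped NNReal ENNReal

namespace SmoothExtension

variable {X Z : Type*} [NormedAddCommGroup X] [NormedAddCommGroup Z]

/-- The restriction of `f` to `A` is Lipschitz. -/
def IsLip (f : X → Z) (A : Set X) : Prop :=
  ∃ L : ℝ≥0, LipschitzOnWith L f A

/-- `Lip(f|_A)`, the least Lipschitz constant of `f` on `A` (meaningful when `IsLip f A`). -/
noncomputable def lip (f : X → Z) (A : Set X) : ℝ≥0 :=
  sInf {L : ℝ≥0 | LipschitzOnWith L f A}

/-- The infimum defining `lip` is attained. -/
theorem IsLip.lipschitzOnWith_lip {f : X → Z} {A : Set X} (hf : IsLip f A) :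
    LipschitzOnWith (lip f A) f A := by
  have hclosed : IsClosed {L : ℝ≥0 | LipschitzOnWith L f A} := by
    have h : {L : ℝ≥0 | LipschitzOnWith L f A} =
        ⋂ x ∈ A, ⋂ y ∈ A, {L : ℝ≥0 | dist (f x) (f y) ≤ L * dist x y} := by
      ext L
      simp [lipschitzOnWith_iff_dist_le_mul]
    rw [h]
    refine isClosed_biInter fun x _ => isClosed_biInter fun y _ => ?_
    exact isClosed_le continuous_const (by fun_prop)
  exact hclosed.csInf_mem hf (OrderBot.bddBelow _)

theorem lip_le {f : X → Z} {A : Set X} {L : ℝ≥0} (h : LipschitzOnWith L f A) :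
    lip f A ≤ L :=
  csInf_le (OrderBot.bddBelow _) h

variable [NormedSpace ℝ X] [NormedSpace ℝ Z]

variable (X Z) in
/-- The pair `(X, Z)` has property (*) with constant `C₀`: Lipschitz maps from arbitrary subsets
of `X` to `Z` are uniformly approximated by `C¹` Lipschitz maps defined on all of `X`, at the cost
of a factor `C₀` in the Lipschitz constant. -/
def PropertyStar (C₀ : ℝ≥0) : Prop :=
  ∀ (A : Set X) (f : X → Z) (L : ℝ≥0), LipschitzOnWith L f A → ∀ η : ℝ, 0 < η →
    ∃ g : X → Z, ContDiff ℝ 1 g ∧ LipschitzWith (C₀ * L) g ∧ ∀ x ∈ A, ‖f x - g x‖ < η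

variable (X Z) in
/-- The pair `(X, Z)` has property (E) with constant `K`: Lipschitz maps from arbitrary subsets
of `X` to `Z` extend to all of `X`, at the cost of a factor `K` in the Lipschitz constant. -/
def PropertyE (K : ℝ≥0) : Prop :=
  ∀ (A : Set X) (f : X → Z) (L : ℝ≥0), LipschitzOnWith L f A →
    ∃ F : X → Z, LipschitzWith (K * L) F ∧ Set.EqOn F f A

/-- `f` satisfies the mean value condition on `A` for the (continuous) map `D : A → L(X, Z)`. -/
structure MeanValueCondition (f : X → Z) (D : X → X →L[ℝ] Z) (A : Set X) : Prop where
  continuousOn : ContinuousOn D A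
  approx : ∀ y ∈ A, ∀ η : ℝ, 0 < η → ∃ r : ℝ, 0 < r ∧
    ∀ z ∈ A ∩ Metric.ball y r, ∀ w ∈ A ∩ Metric.ball y r,
      ‖f z - f w - D y (z - w)‖ ≤ η * ‖z - w‖

/-- `L₂ = ε'/C₀ + Lip(f)`, where `ℓ` stands for `Lip(f)`. -/
noncomputable def L₂ (C₀ ε' ℓ : ℝ) : ℝ := ε' / C₀ + ℓ

/-- `L₃ = max {2δ(ε'/(8C₀) + ε' + M) + L₂(2δ + 1), ε'/(8C₀) + ε' + M}`, with `δ = 2/(τ - 2)`. -/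
noncomputable def L₃ (C₀ ε' ℓ M τ : ℝ) : ℝ :=
  max (2 * (2 / (τ - 2)) * (ε' / (8 * C₀) + ε' + M) + L₂ C₀ ε' ℓ * (2 * (2 / (τ - 2)) + 1))
    (ε' / (8 * C₀) + ε' + M)

/-- `L₄ = ε'/4 + C₀ K L₃`. -/
noncomputable def L₄ (C₀ K ε' ℓ M τ : ℝ) : ℝ := ε' / 4 + C₀ * K * L₃ C₀ ε' ℓ M τ

/-- `Q₁ = (K + 1)(R + ε' + ε'/(8C₀)) + ε'/8`. -/
noncomputable def Q₁ (C₀ K ε' R : ℝ) : ℝ := (K + 1) * (R + ε' + ε' / (8 * C₀)) + ε' / 8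

end SmoothExtension

namespace SmoothExtension

open Filter Topology

/-! Near y in A the map f is affine with linear part D y, up to a remainder of small Lipschitz
constant. By (*) the remainder is replaced by a C¹ map, and these local models are glued into a C¹
map g₁ with f - g₁ small on A in value, derivative and Lipschitz seminorm
(`exists_contDiff_approximation`). Nothing controls g₁ far from A.

By continuity the derivative of g₁ stays bounded on balls around the points of A. Two points of the
balls shrunk by τ either share a large ball or are far apart compared with the radii, and are then
joined through the centres; so g₁ is L₃-Lipschitz on an open S containing A
(`lipschitzOnWith_iUnion_ball`). Property (E) extends g₁ from S to a Lipschitz F on X. Finally F is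
glued, over the cover {S, Aᶜ}, with its (*)-approximants (`exists_contDiff_of_contDiffOn`). This
smooths F away from A, keeps its values on A, and costs a factor C₀ in the Lipschitz constant.

Both gluings rest on `exists_glued_approximation`. Stone's construction gives a countable partition
of unity whose members are Lipschitz and whose pieces within one member are uniformly separated. It
is fixed before the approximants, so the accuracy at level n can beat the Lipschitz constant and the
gap of that level; the errors then sum geometrically. -/

/-- Property (*) passes from a nontrivial target to the real line. -/
theorem PropertyStar.real {X Z : Type*} [NormedAddCommGroup X] [NormedSpace ℝ X]
    [NormedAddCommGroup Z] [NormedSpace ℝ Z] [Nontrivial Z] {C : ℝ≥0}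
    (h : PropertyStar X Z C) : PropertyStar X ℝ C := by
  intro A f L hf η hη
  obtain ⟨z, hz⟩ := exists_norm_eq Z (zero_le_one : (0 : ℝ) ≤ 1)
  obtain ⟨e, he, hez⟩ := exists_dual_vector ℝ z (by intro h0; simp [h0] at hz)
  have hez' : e z = 1 := by simpa [hz] using hez
  have hfz : LipschitzOnWith L (fun x => f x • z) A := by
    refine LipschitzOnWith.of_dist_le_mul fun x hx y hy => ?_
    rw [dist_eq_norm, ← sub_smul, norm_smul, hz, mul_one, ← dist_eq_norm]
    exact hf.dist_le_mul x hx y hy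
  obtain ⟨g, hg, hgL, hfg⟩ := h A _ L hfz η hη
  have hnorm : ∀ w, ‖e w‖ ≤ ‖w‖ := fun w => by simpa [he] using e.le_opNorm w
  refine ⟨fun x => e (g x), e.contDiff.comp hg, ?_, fun x hx => ?_⟩
  · refine LipschitzWith.of_dist_le_mul fun x y => ?_
    rw [dist_eq_norm, ← map_sub]
    refine (hnorm _).trans ?_
    rw [← dist_eq_norm]
    exact hgL.dist_le_mul x y
  · have : f x - e (g x) = e (f x • z - g x) := by simp [hez']
    rw [this]
    exact (hnorm _).trans_lt (hfg x hx)

/-! ### Smooth Lipschitz bump functions from (*) -/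

section Bump

variable {X : Type*} [NormedAddCommGroup X] [NormedSpace ℝ X] {C : ℝ≥0}

theorem exists_lipschitz_bump (hX : PropertyStar X ℝ C) (S : Set X) {ρ : ℝ} (hρ : 0 < ρ) :
    ∃ h : X → ℝ, ContDiff ℝ 1 h ∧ (∃ Λ : ℝ≥0, LipschitzWith Λ h) ∧
      (∀ x, 0 ≤ h x ∧ h x ≤ 1) ∧ (∀ x ∈ S, ∀ᶠ y in 𝓝 x, h y = 1) ∧
      tsupport h ⊆ Metric.thickening ρ S := by
  rcases S.eq_empty_or_nonempty with rfl | hS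
  · refine ⟨fun _ => 0, contDiff_const, ⟨0, LipschitzWith.const 0⟩, by simp, by simp, ?_⟩
    have : tsupport (fun _ : X => (0 : ℝ)) = ∅ := by
      rw [tsupport_eq_empty_iff]; rfl
    simp [this]
  have hφ : LipschitzOnWith (Real.toNNReal (1 / ρ)) (fun x => Metric.infDist x S / ρ)
      Set.univ := by
    refine LipschitzOnWith.of_dist_le_mul fun x _ y _ => ?_
    rw [Real.coe_toNNReal _ (by positivity), Real.dist_eq, ← sub_div, abs_div, abs_of_pos hρ,
      one_div, inv_mul_eq_div, ← Real.dist_eq]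
    gcongr
    simpa using (Metric.lipschitz_infDist_pt S).dist_le_mul x y
  obtain ⟨ψ, hψ, hψL, hψφ⟩ := hX _ _ _ hφ (1 / 10) (by norm_num)
  -- With error 1/10 in ψ, infDist/ρ < 1/10 forces |ψ| ≤ 1/4, where b = 1, while |ψ| < 3/4 forces
  -- infDist/ρ ≤ 3/4 + 1/10 = 17/20 < 1.
  let b : ContDiffBump (0 : ℝ) := ⟨1 / 4, 3 / 4, by norm_num, by norm_num⟩
  have hb : ContDiff ℝ 1 (b : ℝ → ℝ) := b.contDiff
  obtain ⟨Λ, hΛ⟩ := hb.lipschitzWith_of_hasCompactSupport b.hasCompactSupport one_ne_zero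
  refine ⟨fun x => b (ψ x), hb.comp hψ, ⟨_, hΛ.comp hψL⟩, fun x => ⟨b.nonneg, b.le_one⟩, ?_, ?_⟩
  · intro x hx
    have hc : ContinuousAt (fun y => Metric.infDist y S / ρ) x := by
      have := Metric.continuous_infDist_pt S
      fun_prop
    have h0 : Metric.infDist x S / ρ < 1 / 10 := by
      rw [Metric.infDist_zero_of_mem hx]; norm_num
    filter_upwards [hc.eventually_lt_const h0] with y hy
    apply b.one_of_mem_closedBall
    have h1 := abs_lt.1 (Real.norm_eq_abs _ ▸ hψφ y trivial)
    have h2 : 0 ≤ Metric.infDist y S / ρ := div_nonneg Metric.infDist_nonneg hρ.le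
    rw [mem_closedBall_zero_iff, Real.norm_eq_abs, abs_le]
    constructor <;> simp only [b] <;> linarith
  · have hsub : tsupport (fun x => b (ψ x)) ⊆ {x | Metric.infDist x S ≤ 17 / 20 * ρ} := by
      refine closure_minimal (fun x hx => ?_)
        (isClosed_le (Metric.continuous_infDist_pt S) continuous_const)
      have hx' : ψ x ∈ Function.support b := hx
      rw [b.support_eq, mem_ball_zero_iff, Real.norm_eq_abs] at hx'
      have h3 := (abs_lt.1 hx').2
      have h1 := abs_lt.1 (Real.norm_eq_abs _ ▸ hψφ x trivial)
      have h4 : Metric.infDist x S / ρ ≤ 17 / 20 := by simp only [b] at h3; linarith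
      exact (div_le_iff₀ hρ).1 h4
    intro x hx
    rw [Metric.mem_thickening_iff_infDist_lt hS]
    have : Metric.infDist x S ≤ 17 / 20 * ρ := hsub hx
    linarith

end Bump

/-! ### Stone's decomposition of an open cover -/

section Partition

variable {X ι : Type*} [PseudoMetricSpace X]

/-- Stone's sets: `x` lies at depth `2⁻ⁿ` in `U i`, but not at depth `2⁻⁽ⁿ⁺¹⁾` in any earlier
`U j`. -/
def stoneSet [LT ι] (U : ι → Set X) (n : ℕ) (i : ι) : Set X :=
  {x | Metric.ball x ((1 / 2) ^ n) ⊆ U i ∧ ∀ j < i, ¬ Metric.ball x ((1 / 2) ^ (n + 1)) ⊆ U j}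

/-- Take the least i with x in U i: no earlier U j contains x, hence none contains a ball around x.
-/
theorem exists_mem_stoneSet [LinearOrder ι] [WellFoundedLT ι] {U : ι → Set X}
    (hU : ∀ i, IsOpen (U i)) (hcov : ∀ x, ∃ i, x ∈ U i) (x : X) : ∃ n i, x ∈ stoneSet U n i := by
  obtain ⟨i, hi, hmin⟩ := wellFounded_lt.has_min {i | x ∈ U i} (hcov x)
  obtain ⟨r, hr, hball⟩ := Metric.isOpen_iff.1 (hU i) x hi
  obtain ⟨n, hn⟩ := exists_pow_lt_of_lt_one hr (by norm_num : (1 / 2 : ℝ) < 1)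
  refine ⟨n, i, (Metric.ball_subset_ball hn.le).trans hball, fun j hj hsub => ?_⟩
  exact hmin j (hsub (Metric.mem_ball_self (by positivity))) hj

/-- For j < i, a point y within 2⁻⁽ⁿ⁺¹⁾ of x would have its 2⁻ⁿ-ball inside U j, and that ball
contains the 2⁻⁽ⁿ⁺¹⁾-ball of x, which is not allowed to lie in U j. -/
theorem stoneSet_separated [LinearOrder ι] {U : ι → Set X} {n : ℕ} {i j : ι} (hij : i ≠ j)
    {x y : X} (hx : x ∈ stoneSet U n i) (hy : y ∈ stoneSet U n j) :
    (1 / 2 : ℝ) ^ (n + 1) < dist x y := by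
  wlog h : j < i generalizing i j x y
  · rw [dist_comm]
    exact this hij.symm hy hx (lt_of_le_of_ne (not_lt.1 h) hij)
  by_contra! hd
  refine hx.2 j h (subset_trans (Metric.ball_subset_ball' ?_) hy.1)
  calc (1 / 2 : ℝ) ^ (n + 1) + dist x y ≤ (1 / 2) ^ (n + 1) + (1 / 2) ^ (n + 1) := by gcongr
    _ = (1 / 2) ^ n := by ring

theorem dist_lt_of_mem_thickening_stoneSet [LinearOrder ι] {U : ι → Set X} {n : ℕ} {i j : ι}
    (hij : i ≠ j) {x y : X} (hx : x ∈ Metric.thickening ((1 / 2) ^ (n + 3)) (stoneSet U n i))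
    (hy : y ∈ Metric.thickening ((1 / 2) ^ (n + 3)) (stoneSet U n j)) :
    (1 / 2 : ℝ) ^ (n + 3) < dist x y := by
  obtain ⟨x', hx', hxx⟩ := Metric.mem_thickening_iff.1 hx
  obtain ⟨y', hy', hyy⟩ := Metric.mem_thickening_iff.1 hy
  have h1 := stoneSet_separated hij hx' hy'
  have h2 : dist x' y' ≤ dist x x' + dist x y + dist y y' := by
    rw [dist_comm x x']
    exact dist_triangle4 x' x y y'
  have h3 : (1 / 2 : ℝ) ^ (n + 1) = 4 * (1 / 2) ^ (n + 3) := by ring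
  have h4 : (0 : ℝ) < (1 / 2) ^ (n + 3) := by positivity
  linarith

theorem thickening_stoneSet_subset [LT ι] {U : ι → Set X} {n : ℕ} {i : ι} :
    Metric.thickening ((1 / 2) ^ (n + 3)) (stoneSet U n i) ⊆ U i := by
  intro x hx
  obtain ⟨x', hx', hxx⟩ := Metric.mem_thickening_iff.1 hx
  refine hx'.1 (Metric.mem_ball.2 (hxx.trans_le ?_))
  exact pow_le_pow_of_le_one (by norm_num) (by norm_num) (by omega)

end Partition

/-- A countable `C¹` Lipschitz partition of unity on `X`, whose `n`-th member is supported in a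
discrete union of pieces, the piece around `x` lying in `U (index n x)`. -/
structure DiscretePartition {X ι : Type*} [NormedAddCommGroup X] [NormedSpace ℝ X]
    (U : ι → Set X) where
  weight : ℕ → X → ℝ
  index : ℕ → X → ι
  gap : ℕ → ℝ
  lipConst : ℕ → ℝ≥0
  contDiff : ∀ n, ContDiff ℝ 1 (weight n)
  nonneg : ∀ n x, 0 ≤ weight n x
  lipschitz : ∀ n, LipschitzWith (lipConst n) (weight n)
  eventually_sum : ∀ x, ∃ N, ∀ᶠ y in 𝓝 x,
    (∀ n, N ≤ n → weight n y = 0) ∧ ∑ n ∈ Finset.range N, weight n y = 1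
  mem_index : ∀ n, ∀ x ∈ tsupport (weight n), x ∈ U (index n x)
  eventually_index : ∀ n, ∀ x ∈ tsupport (weight n), ∀ᶠ y in 𝓝 x, index n y = index n x
  gap_pos : ∀ n, 0 < gap n
  gap_le : ∀ n x y, weight n x ≠ 0 → weight n y ≠ 0 → index n x ≠ index n y → gap n ≤ dist x y

/-! ### Turning bumps into a partition of unity -/

section Products

variable {X : Type*}

/-- A telescoping sum: the weights h n ∏_{j<n} (1 - h j) add up to 1, and all later ones vanish, as
soon as one h n equals 1. -/
theorem sum_mul_prod_one_sub (h : ℕ → X → ℝ) (x : X) (N : ℕ) :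
    ∑ n ∈ Finset.range N, h n x * ∏ j ∈ Finset.range n, (1 - h j x) =
      1 - ∏ j ∈ Finset.range N, (1 - h j x) := by
  induction N with
  | zero => simp
  | succ N ih => rw [Finset.sum_range_succ, ih, Finset.prod_range_succ]; ring

theorem exists_lipschitzWith_mul [PseudoMetricSpace X] {u v : X → ℝ} (hu : ∀ x, 0 ≤ u x ∧ u x ≤ 1)
    (hv : ∀ x, 0 ≤ v x ∧ v x ≤ 1) (hu' : ∃ Λ : ℝ≥0, LipschitzWith Λ u)
    (hv' : ∃ Λ : ℝ≥0, LipschitzWith Λ v) : ∃ Λ : ℝ≥0, LipschitzWith Λ fun x => u x * v x := by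
  obtain ⟨a, ha⟩ := hu'
  obtain ⟨b, hb⟩ := hv'
  refine ⟨a + b, LipschitzWith.of_dist_le_mul fun x y => ?_⟩
  have h1 := ha.dist_le_mul x y
  have h2 := hb.dist_le_mul x y
  rw [Real.dist_eq] at h1 h2 ⊢
  have h3 : u x * v x - u y * v y = (u x - u y) * v x + u y * (v x - v y) := by ring
  rw [h3]
  refine (abs_add_le _ _).trans ?_
  rw [abs_mul, abs_mul, abs_of_nonneg (hv x).1, abs_of_nonneg (hu y).1]
  have h4 : |u x - u y| * v x ≤ |u x - u y| := mul_le_of_le_one_right (abs_nonneg _) (hv x).2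
  have h5 : u y * |v x - v y| ≤ |v x - v y| := mul_le_of_le_one_left (abs_nonneg _) (hu y).2
  push_cast
  linarith

theorem prod_one_sub_mem {h : ℕ → X → ℝ} (hh : ∀ n x, 0 ≤ h n x ∧ h n x ≤ 1) (n : ℕ) (x : X) :
    0 ≤ ∏ j ∈ Finset.range n, (1 - h j x) ∧ ∏ j ∈ Finset.range n, (1 - h j x) ≤ 1 :=
  ⟨Finset.prod_nonneg fun j _ => by linarith [(hh j x).2],
    Finset.prod_le_one (fun j _ => by linarith [(hh j x).2]) fun j _ => by linarith [(hh j x).1]⟩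

theorem exists_lipschitzWith_prod_one_sub [PseudoMetricSpace X] {h : ℕ → X → ℝ}
    (hh : ∀ n x, 0 ≤ h n x ∧ h n x ≤ 1) (hL : ∀ n, ∃ Λ : ℝ≥0, LipschitzWith Λ (h n)) (n : ℕ) :
    ∃ Λ : ℝ≥0, LipschitzWith Λ fun x => ∏ j ∈ Finset.range n, (1 - h j x) := by
  induction n with
  | zero => exact ⟨0, by simp⟩
  | succ n ih =>
    simp only [Finset.prod_range_succ]
    refine exists_lipschitzWith_mul (prod_one_sub_mem hh n)
      (fun x => ⟨by linarith [(hh n x).2], by linarith [(hh n x).1]⟩) ih ?_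
    obtain ⟨Λ, hΛ⟩ := hL n
    refine ⟨Λ, LipschitzWith.of_dist_le_mul fun x y => ?_⟩
    rw [Real.dist_eq, sub_sub_sub_cancel_left, ← Real.dist_eq, dist_comm]
    exact hΛ.dist_le_mul x y

end Products

/-- Level n uses a single bump around the union of all n-th Stone sets. Separation makes the
thickened sets disjoint, so the piece containing a point determines its index, and countably many
functions suffice for an arbitrary cover. -/
theorem nonempty_discretePartition {X ι : Type*} [NormedAddCommGroup X] [NormedSpace ℝ X] {C : ℝ≥0}
    (hX : PropertyStar X ℝ C) {U : ι → Set X} (hU : ∀ i, IsOpen (U i))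
    (hcov : ∀ x, ∃ i, x ∈ U i) : Nonempty (DiscretePartition U) := by
  classical
  obtain ⟨_, _⟩ := exists_wellFoundedLT ι
  let W : ℕ → ι → Set X := fun n i => Metric.thickening ((1 / 2) ^ (n + 3)) (stoneSet U n i)
  have hρ : ∀ n : ℕ, (0 : ℝ) < (1 / 2) ^ (n + 3) := fun n => by positivity
  choose h hC hL h01 hone hsupp using fun n : ℕ =>
    exists_lipschitz_bump hX (⋃ i, stoneSet U n i) (hρ n)
  have hW : ∀ n, tsupport (h n) ⊆ ⋃ i, W n i := fun n => by
    refine (hsupp n).trans ?_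
    rw [Metric.thickening_iUnion]
  have : Nonempty ι := ⟨(hcov 0).choose⟩
  -- Off the thickened sets the index is an arbitrary value; the n-th weight vanishes there.
  let idx : ℕ → X → ι := fun n x => Classical.epsilon fun i => x ∈ W n i
  have hidx : ∀ n i x, x ∈ W n i → idx n x = i := by
    intro n i x hx
    have h1 : x ∈ W n (idx n x) := Classical.epsilon_spec (p := fun i => x ∈ W n i) ⟨i, hx⟩
    by_contra hne
    have := dist_lt_of_mem_thickening_stoneSet hne h1 hx
    rw [dist_self] at this
    exact absurd this (not_lt.2 (hρ n).le)
  let w : ℕ → X → ℝ := fun n x => h n x * ∏ j ∈ Finset.range n, (1 - h j x)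
  have hts : ∀ n, tsupport (w n) ⊆ tsupport (h n) := fun n => tsupport_mul_subset_left
  choose Λ hΛ using fun n => exists_lipschitzWith_mul (h01 n) (prod_one_sub_mem h01 n) (hL n)
    (exists_lipschitzWith_prod_one_sub h01 hL n)
  refine ⟨⟨w, idx, fun n => (1 / 2) ^ (n + 3), Λ, ?_, ?_, hΛ, ?_, ?_, ?_, hρ, ?_⟩⟩
  · intro n
    exact (hC n).mul (contDiff_prod fun j _ => contDiff_const.sub (hC j))
  · exact fun n x => mul_nonneg (h01 n x).1 (prod_one_sub_mem h01 n x).1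
  · intro x
    obtain ⟨n, i, hx⟩ := exists_mem_stoneSet hU hcov x
    refine ⟨n + 1, ?_⟩
    filter_upwards [hone n x (Set.mem_iUnion.2 ⟨i, hx⟩)] with y hy
    have hz : ∀ m, n + 1 ≤ m → ∏ j ∈ Finset.range m, (1 - h j y) = 0 := fun m hm =>
      Finset.prod_eq_zero (Finset.mem_range.2 hm) (by rw [hy, sub_self])
    refine ⟨fun m hm => ?_, ?_⟩
    · simp only [w, hz m hm, mul_zero]
    · simp only [w, sum_mul_prod_one_sub, hz _ le_rfl, sub_zero]
  · intro n x hx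
    obtain ⟨i, hi⟩ := Set.mem_iUnion.1 (hW n (hts n hx))
    rw [hidx n i x hi]
    exact thickening_stoneSet_subset hi
  · intro n x hx
    obtain ⟨i, hi⟩ := Set.mem_iUnion.1 (hW n (hts n hx))
    filter_upwards [Metric.isOpen_thickening.mem_nhds hi] with y hy
    rw [hidx n i x hi, hidx n i y hy]
  · intro n x y hx hy hne
    obtain ⟨i, hi⟩ := Set.mem_iUnion.1 (hW n (hts n (subset_tsupport _ hx)))
    obtain ⟨j, hj⟩ := Set.mem_iUnion.1 (hW n (hts n (subset_tsupport _ hy)))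
    rw [hidx n i x hi, hidx n j y hj] at hne
    exact (dist_lt_of_mem_thickening_stoneSet hne hi hj).le

/-! ### Gluing local approximants -/

section Glue

variable {X Z ι : Type*} [NormedAddCommGroup X] [NormedSpace ℝ X]
  [NormedAddCommGroup Z] [NormedSpace ℝ Z] {U : ι → Set X}

namespace DiscretePartition

variable (P : DiscretePartition U)

theorem weight_eq_sum_one (x : X) : ∃ N, (∀ n, N ≤ n → P.weight n x = 0) ∧
    ∑ n ∈ Finset.range N, P.weight n x = 1 := by
  obtain ⟨N, hN⟩ := P.eventually_sum x
  exact ⟨N, hN.self_of_nhds⟩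

theorem sum_weight_of_le {x : X} {N M : ℕ} (hNM : N ≤ M) (h : ∀ n, N ≤ n → P.weight n x = 0)
    (h1 : ∑ n ∈ Finset.range N, P.weight n x = 1) : ∑ n ∈ Finset.range M, P.weight n x = 1 := by
  rw [← h1]
  refine (Finset.sum_subset (Finset.range_mono hNM) fun n _ hn => h n ?_).symm
  simpa using hn

/-- The accuracy required of the local approximants used on the `n`-th level. -/
noncomputable def tol (θ : ℝ) (n : ℕ) : ℝ :=
  θ * (1 / 2) ^ (n + 1) / (1 + P.lipConst n + 2 / P.gap n)

theorem tol_denom_pos (n : ℕ) : 0 < 1 + (P.lipConst n : ℝ) + 2 / P.gap n := by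
  have := P.gap_pos n
  positivity

theorem tol_pos {θ : ℝ} (hθ : 0 < θ) (n : ℕ) : 0 < P.tol θ n :=
  div_pos (by positivity) (P.tol_denom_pos n)

/-- Each term of the denominator pays for one estimate: 1 for values, the Lipschitz constant for
differences and derivatives of the weight, and 2 / gap for jumps between pieces. -/
theorem tol_mul (θ : ℝ) (n : ℕ) :
    P.tol θ n * (1 + P.lipConst n + 2 / P.gap n) = θ * (1 / 2) ^ (n + 1) :=
  div_mul_cancel₀ _ (P.tol_denom_pos n).ne'

theorem tol_le {θ : ℝ} (hθ : 0 < θ) (n : ℕ) : P.tol θ n ≤ θ := by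
  have h1 := P.tol_mul θ n
  have h2 := P.tol_pos hθ n
  have h3 : 0 ≤ (P.lipConst n : ℝ) + 2 / P.gap n := by
    have := P.gap_pos n
    positivity
  have h4 : (1 / 2 : ℝ) ^ (n + 1) ≤ 1 := pow_le_one₀ (by norm_num) (by norm_num)
  nlinarith [mul_nonneg h2.le h3]

theorem lipConst_mul_tol_le {θ : ℝ} (hθ : 0 < θ) (n : ℕ) :
    P.lipConst n * P.tol θ n ≤ θ * (1 / 2) ^ (n + 1) := by
  rw [← P.tol_mul, mul_comm]
  have := P.gap_pos n
  have h2 : 0 ≤ 2 / P.gap n := by positivity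
  gcongr
  · exact (P.tol_pos hθ n).le
  · linarith

theorem two_mul_tol_le {θ : ℝ} (hθ : 0 < θ) (n : ℕ) {d : ℝ} (hd : P.gap n ≤ d) :
    2 * P.tol θ n ≤ θ * (1 / 2) ^ (n + 1) * d := by
  have h1 := P.gap_pos n
  have h2 := P.tol_pos hθ n
  have h3 : 2 * P.tol θ n = P.tol θ n * (2 / P.gap n) * P.gap n := by field_simp
  rw [h3, ← P.tol_mul]
  have h4 : (0 : ℝ) ≤ P.lipConst n := (P.lipConst n).2
  gcongr
  linarith

/-- The local approximants `G n i` glued along the partition. -/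
noncomputable def glue (G : ℕ → ι → X → Z) (x : X) : Z :=
  ∑ᶠ n, P.weight n x • G n (P.index n x) x

variable {P} {G : ℕ → ι → X → Z}

theorem glue_eq_sum {x : X} {N : ℕ} (h : ∀ n, N ≤ n → P.weight n x = 0) :
    P.glue G x = ∑ n ∈ Finset.range N, P.weight n x • G n (P.index n x) x := by
  refine finsum_eq_sum_of_support_subset _ fun n hn => ?_
  by_contra hN
  exact hn (by simp [h n (by simpa using hN)])

theorem mem_index_of_weight_ne_zero {n : ℕ} {x : X} (h : P.weight n x ≠ 0) :
    x ∈ U (P.index n x) :=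
  P.mem_index n x (subset_tsupport _ h)

/-- Near a point of the support of the `n`-th weight, the `n`-th summand of the glued map is given
by a single local approximant. -/
theorem eventually_summand_eq {n : ℕ} {x : X} (hx : x ∈ tsupport (P.weight n)) :
    (fun y => P.weight n y • G n (P.index n y) y) =ᶠ[𝓝 x]
      fun y => P.weight n y • G n (P.index n x) y := by
  filter_upwards [P.eventually_index n x hx] with y hy
  rw [hy]

theorem eventually_summand_eq_zero {n : ℕ} {x : X} (hx : x ∉ tsupport (P.weight n)) :
    (fun y => P.weight n y • G n (P.index n y) y) =ᶠ[𝓝 x] fun _ => 0 := by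
  filter_upwards [notMem_tsupport_iff_eventuallyEq.1 hx] with y hy
  simp [hy]

theorem contDiffAt_summand (hU : ∀ i, IsOpen (U i)) (hG : ∀ n i, ContDiffOn ℝ 1 (G n i) (U i))
    (n : ℕ) (x : X) : ContDiffAt ℝ 1 (fun y => P.weight n y • G n (P.index n y) y) x := by
  by_cases hx : x ∈ tsupport (P.weight n)
  · refine ContDiffAt.congr_of_eventuallyEq ?_ (eventually_summand_eq hx)
    exact (P.contDiff n).contDiffAt.smul
      ((hG n _).contDiffAt ((hU _).mem_nhds (P.mem_index n x hx)))
  · exact contDiffAt_const.congr_of_eventuallyEq (eventually_summand_eq_zero hx)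

theorem eventually_glue_eq (x : X) : ∃ N, P.glue G =ᶠ[𝓝 x]
      (fun y => ∑ n ∈ Finset.range N, P.weight n y • G n (P.index n y) y) ∧
    (fun y => ∑ n ∈ Finset.range N, P.weight n y) =ᶠ[𝓝 x] fun _ => 1 := by
  obtain ⟨N, hN⟩ := P.eventually_sum x
  exact ⟨N, hN.mono fun y hy => glue_eq_sum hy.1, hN.mono fun y hy => hy.2⟩

theorem contDiff_glue (hU : ∀ i, IsOpen (U i)) (hG : ∀ n i, ContDiffOn ℝ 1 (G n i) (U i)) :
    ContDiff ℝ 1 (P.glue G) := by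
  rw [contDiff_iff_contDiffAt]
  intro x
  obtain ⟨N, hN, -⟩ := eventually_glue_eq (P := P) (G := G) x
  exact (ContDiffAt.sum fun n _ => contDiffAt_summand hU hG n x).congr_of_eventuallyEq hN

theorem norm_glue_sub_le {x : X} {v : Z} {c : ℝ}
    (h : ∀ n, x ∈ U (P.index n x) → ‖G n (P.index n x) x - v‖ ≤ c) : ‖P.glue G x - v‖ ≤ c := by
  obtain ⟨N, hN, h1⟩ := P.weight_eq_sum_one x
  have : P.glue G x - v =
      ∑ n ∈ Finset.range N, P.weight n x • (G n (P.index n x) x - v) := by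
    simp only [smul_sub, Finset.sum_sub_distrib, ← Finset.sum_smul, h1, one_smul, glue_eq_sum hN]
  rw [this]
  calc _ ≤ ∑ n ∈ Finset.range N, P.weight n x * c := by
        refine norm_sum_le_of_le _ fun n _ => ?_
        rw [norm_smul, Real.norm_of_nonneg (P.nonneg n x)]
        by_cases h0 : P.weight n x = 0
        · simp [h0]
        · exact mul_le_mul_of_nonneg_left (h n (mem_index_of_weight_ne_zero h0)) (P.nonneg n x)
    _ = c := by rw [← Finset.sum_mul, h1, one_mul]

theorem sum_half_pow_le (N : ℕ) : ∑ n ∈ Finset.range N, (1 / 2 : ℝ) ^ (n + 1) ≤ 1 := by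
  have : ∑ n ∈ Finset.range N, (1 / 2 : ℝ) ^ (n + 1) = 1 - (1 / 2) ^ N := by
    induction N with
    | zero => simp
    | succ N ih => rw [Finset.sum_range_succ, ih]; ring
  rw [this]
  have : (0 : ℝ) < (1 / 2) ^ N := by positivity
  linarith

/-- By the Leibniz rule; the error in the value enters multiplied by the derivative of the weight,
which `tol` is chosen to absorb. -/
theorem norm_fderiv_summand_sub_le (hU : ∀ i, IsOpen (U i))
    (hG : ∀ n i, ContDiffOn ℝ 1 (G n i) (U i)) {θ : ℝ} (hθ : 0 < θ) {x : X} {v : Z}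
    {T : X →L[ℝ] Z} {c : ℝ} {n : ℕ}
    (hv : x ∈ U (P.index n x) → ‖G n (P.index n x) x - v‖ ≤ P.tol θ n)
    (hT : x ∈ U (P.index n x) → ‖fderiv ℝ (G n (P.index n x)) x - T‖ ≤ c) :
    ‖fderiv ℝ (fun y => P.weight n y • G n (P.index n y) y) x -
        (P.weight n x • T + (fderiv ℝ (P.weight n) x).smulRight v)‖ ≤
      P.weight n x * c + θ * (1 / 2) ^ (n + 1) := by
  by_cases hx : x ∈ tsupport (P.weight n)
  · have hxU := P.mem_index n x hx
    have hGd : DifferentiableAt ℝ (G n (P.index n x)) x :=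
      ((hG n _).contDiffAt ((hU _).mem_nhds hxU)).differentiableAt one_ne_zero
    have hwd : DifferentiableAt ℝ (P.weight n) x :=
      (P.contDiff n).contDiffAt.differentiableAt one_ne_zero
    rw [(eventually_summand_eq hx).fderiv_eq, fderiv_fun_smul hwd hGd]
    have heq : P.weight n x • fderiv ℝ (G n (P.index n x)) x +
          (fderiv ℝ (P.weight n) x).smulRight (G n (P.index n x) x) -
        (P.weight n x • T + (fderiv ℝ (P.weight n) x).smulRight v) =
        P.weight n x • (fderiv ℝ (G n (P.index n x)) x - T) +
          (fderiv ℝ (P.weight n) x).smulRight (G n (P.index n x) x - v) := by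
      ext y
      simp [smul_sub]
      abel
    rw [heq]
    refine (norm_add_le _ _).trans (add_le_add ?_ ?_)
    · rw [norm_smul, Real.norm_of_nonneg (P.nonneg n x)]
      exact mul_le_mul_of_nonneg_left (hT hxU) (P.nonneg n x)
    · rw [ContinuousLinearMap.norm_smulRight_apply]
      refine le_trans ?_ (P.lipConst_mul_tol_le hθ n)
      gcongr
      · exact norm_fderiv_le_of_lipschitz ℝ (P.lipschitz n)
      · exact hv hxU
  · have h0 : P.weight n x = 0 := image_eq_zero_of_notMem_tsupport hx
    have h1 : fderiv ℝ (P.weight n) x = 0 := by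
      rw [(notMem_tsupport_iff_eventuallyEq.1 hx).fderiv_eq]
      exact fderiv_const_apply 0
    rw [(eventually_summand_eq_zero hx).fderiv_eq, h0, h1]
    have : (0 : X →L[ℝ] ℝ).smulRight v = 0 := by ext; simp
    simp [this]
    positivity

theorem norm_fderiv_glue_sub_le (hU : ∀ i, IsOpen (U i))
    (hG : ∀ n i, ContDiffOn ℝ 1 (G n i) (U i)) {θ : ℝ} (hθ : 0 < θ) {x : X} {v : Z}
    {T : X →L[ℝ] Z} {c : ℝ}
    (hv : ∀ n, x ∈ U (P.index n x) → ‖G n (P.index n x) x - v‖ ≤ P.tol θ n)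
    (hT : ∀ n, x ∈ U (P.index n x) → ‖fderiv ℝ (G n (P.index n x)) x - T‖ ≤ c) :
    ‖fderiv ℝ (P.glue G) x - T‖ ≤ c + θ := by
  obtain ⟨N, hN, h1⟩ := eventually_glue_eq (P := P) (G := G) x
  -- The weights sum to 1 near x, so their derivatives cancel and the terms containing v drop out.
  have hw : ∑ n ∈ Finset.range N, fderiv ℝ (P.weight n) x = 0 := by
    rw [← fderiv_fun_sum fun n _ => (P.contDiff n).contDiffAt.differentiableAt one_ne_zero,
      h1.fderiv_eq]
    exact fderiv_const_apply 1
  have hw1 : ∑ n ∈ Finset.range N, P.weight n x = 1 := h1.self_of_nhds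
  have hsm : ∑ n ∈ Finset.range N, (fderiv ℝ (P.weight n) x).smulRight v = 0 := by
    ext y
    have := congrArg (fun l : X →L[ℝ] ℝ => l y • v) hw
    simpa [_root_.sum_apply, Finset.sum_smul] using this
  have heq : fderiv ℝ (P.glue G) x - T = ∑ n ∈ Finset.range N,
      (fderiv ℝ (fun y => P.weight n y • G n (P.index n y) y) x -
        (P.weight n x • T + (fderiv ℝ (P.weight n) x).smulRight v)) := by
    rw [hN.fderiv_eq, fderiv_fun_sum fun n _ =>
        (contDiffAt_summand hU hG n x).differentiableAt one_ne_zero,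
      Finset.sum_sub_distrib, Finset.sum_add_distrib, hsm, ← Finset.sum_smul, hw1, one_smul,
      add_zero]
  rw [heq]
  refine (norm_sum_le_of_le _ fun n _ =>
    norm_fderiv_summand_sub_le hU hG hθ (hv n) (hT n)).trans ?_
  rw [Finset.sum_add_distrib, ← Finset.sum_mul, hw1, one_mul, ← Finset.mul_sum]
  have := mul_le_mul_of_nonneg_left (sum_half_pow_le N) hθ.le
  linarith

/-- Within one piece this is the product rule for differences. For points in different pieces there
is no relation between the two approximants, but they are at least `gap n` apart, so smallness of
both values is enough. -/
theorem norm_weight_smul_sub_le {θ : ℝ} (hθ : 0 < θ) {n : ℕ} {c : ℝ} (hc : 0 ≤ c) {z w : X}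
    {E : ι → X → Z} (hz : z ∈ U (P.index n z) → ‖E (P.index n z) z‖ ≤ P.tol θ n)
    (hw : w ∈ U (P.index n w) → ‖E (P.index n w) w‖ ≤ P.tol θ n)
    (hE : ∀ i, z ∈ U i → w ∈ U i → ‖E i z - E i w‖ ≤ c * dist z w) :
    ‖P.weight n z • E (P.index n z) z - P.weight n w • E (P.index n w) w‖ ≤
      P.weight n z * (c * dist z w) + θ * (1 / 2) ^ (n + 1) * dist z w := by
  have hlip : ‖P.weight n z - P.weight n w‖ * P.tol θ n ≤ θ * (1 / 2) ^ (n + 1) * dist z w := by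
    have h1 := (P.lipschitz n).dist_le_mul z w
    rw [dist_eq_norm] at h1
    calc _ ≤ P.lipConst n * dist z w * P.tol θ n := by
          exact mul_le_mul_of_nonneg_right h1 (P.tol_pos hθ n).le
      _ = P.lipConst n * P.tol θ n * dist z w := by ring
      _ ≤ _ := by
          exact mul_le_mul_of_nonneg_right (P.lipConst_mul_tol_le hθ n) dist_nonneg
  have hnn : 0 ≤ P.weight n z * (c * dist z w) := mul_nonneg (P.nonneg n z) (by positivity)
  by_cases hz0 : P.weight n z = 0
  · by_cases hw0 : P.weight n w = 0
    · simp only [hz0, hw0, zero_smul, sub_zero, norm_zero, zero_mul, zero_add]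
      positivity
    · rw [hz0, zero_smul, zero_sub, norm_neg, norm_smul, zero_mul, zero_add]
      rw [hz0, zero_sub, norm_neg] at hlip
      refine le_trans ?_ hlip
      gcongr
      exact hw (mem_index_of_weight_ne_zero hw0)
  have hz' := hz (mem_index_of_weight_ne_zero hz0)
  by_cases hw0 : P.weight n w = 0
  · rw [hw0, zero_smul, sub_zero, norm_smul]
    rw [hw0, sub_zero] at hlip
    have : ‖P.weight n z‖ * ‖E (P.index n z) z‖ ≤ ‖P.weight n z‖ * P.tol θ n := by gcongr
    linarith
  have hw' := hw (mem_index_of_weight_ne_zero hw0)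
  by_cases hi : P.index n z = P.index n w
  · have heq : P.weight n z • E (P.index n z) z - P.weight n w • E (P.index n w) w =
        P.weight n z • (E (P.index n z) z - E (P.index n z) w) +
          (P.weight n z - P.weight n w) • E (P.index n w) w := by
      rw [← hi, smul_sub, sub_smul]
      abel
    rw [heq]
    refine (norm_add_le _ _).trans (add_le_add ?_ ?_)
    · rw [norm_smul, Real.norm_of_nonneg (P.nonneg n z)]
      refine mul_le_mul_of_nonneg_left (hE _ (mem_index_of_weight_ne_zero hz0) ?_) (P.nonneg n z)
      rw [hi]
      exact mem_index_of_weight_ne_zero hw0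
    · rw [norm_smul]
      refine le_trans ?_ hlip
      gcongr
  · have hle : ∀ y, P.weight n y ≤ 1 := fun y => by
      obtain ⟨N, hN, h1⟩ := P.weight_eq_sum_one y
      by_cases hn : n < N
      · rw [← h1]
        exact Finset.single_le_sum (f := fun n => P.weight n y) (fun m _ => P.nonneg m y)
          (Finset.mem_range.2 hn)
      · rw [hN n (not_lt.1 hn)]
        exact zero_le_one
    have hterm : ∀ y, ‖E (P.index n y) y‖ ≤ P.tol θ n →
        ‖P.weight n y • E (P.index n y) y‖ ≤ P.tol θ n := fun y hy => by
      rw [norm_smul, Real.norm_of_nonneg (P.nonneg n y)]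
      exact (mul_le_of_le_one_left (norm_nonneg _) (hle y)).trans hy
    have h2 := P.two_mul_tol_le hθ n (P.gap_le n z w hz0 hw0 hi)
    have h3 := norm_sub_le (P.weight n z • E (P.index n z) z) (P.weight n w • E (P.index n w) w)
    linarith [hterm z hz', hterm w hw']

/-- B need not be convex, so derivative bounds would not give this; the two-point estimates of the
summands are added instead. -/
theorem lipschitzOnWith_sub_glue {B : Set X} {F : X → Z} {θ c : ℝ≥0} (hθ : 0 < θ)
    (hv : ∀ n, ∀ x ∈ B, x ∈ U (P.index n x) → ‖F x - G n (P.index n x) x‖ ≤ P.tol θ n)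
    (hE : ∀ n i, LipschitzOnWith c (F - G n i) (U i ∩ B)) :
    LipschitzOnWith (c + θ) (F - P.glue G) B := by
  refine LipschitzOnWith.of_dist_le_mul fun z hz w hw => ?_
  obtain ⟨N₁, hN₁, h₁⟩ := P.weight_eq_sum_one z
  obtain ⟨N₂, hN₂, h₂⟩ := P.weight_eq_sum_one w
  set N := max N₁ N₂
  have hzero : ∀ x, x = z ∨ x = w → ∀ n, N ≤ n → P.weight n x = 0 := by
    rintro x (rfl | rfl) n hn
    · exact hN₁ n ((le_max_left _ _).trans hn)
    · exact hN₂ n ((le_max_right _ _).trans hn)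
  have hone : ∀ x, x = z ∨ x = w → ∑ n ∈ Finset.range N, P.weight n x = 1 := by
    rintro x (rfl | rfl)
    · exact P.sum_weight_of_le (le_max_left _ _) hN₁ h₁
    · exact P.sum_weight_of_le (le_max_right _ _) hN₂ h₂
  have hrep : ∀ x, x = z ∨ x = w → (F - P.glue G) x =
      ∑ n ∈ Finset.range N, P.weight n x • (F - G n (P.index n x)) x := fun x hx => by
    simp only [Pi.sub_apply, smul_sub, Finset.sum_sub_distrib, ← Finset.sum_smul, hone x hx,
      one_smul, glue_eq_sum (hzero x hx)]
  rw [dist_eq_norm, hrep z (.inl rfl), hrep w (.inr rfl), ← Finset.sum_sub_distrib]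
  have hbound := norm_sum_le_of_le (Finset.range N) fun n _ =>
    norm_weight_smul_sub_le (P := P) (n := n) (E := fun i => F - G n i) (z := z) (w := w)
      (NNReal.coe_pos.2 hθ) c.2 (hv n z hz) (hv n w hw) fun i hzi hwi => by
        rw [← dist_eq_norm]
        exact (hE n i).dist_le_mul z ⟨hzi, hz⟩ w ⟨hwi, hw⟩
  refine hbound.trans ?_
  rw [Finset.sum_add_distrib, ← Finset.sum_mul, hone z (.inl rfl), one_mul, ← Finset.sum_mul,
    ← Finset.mul_sum]
  push_cast
  rw [add_mul]
  have := mul_le_of_le_one_right θ.2 (sum_half_pow_le N)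
  exact add_le_add_right (mul_le_mul_of_nonneg_right this dist_nonneg) _

end DiscretePartition

/-- Gluing of local `C¹` approximants. If on every member `U i` of an open cover the map `F` has
arbitrarily good `C¹` approximations on `U i ∩ B`, then a global `C¹` map `g` inherits their
common properties at the points of `B`. -/
theorem exists_glued_approximation {C : ℝ≥0} (hX : PropertyStar X ℝ C) (hU : ∀ i, IsOpen (U i))
    (hcov : ∀ x, ∃ i, x ∈ U i) (B : Set X) (F : X → Z) (G : ι → ℝ → X → Z)
    (hG : ∀ i η, 0 < η → ContDiffOn ℝ 1 (G i η) (U i))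
    (hGF : ∀ i η, 0 < η → ∀ x ∈ U i ∩ B, ‖F x - G i η x‖ ≤ η) {θ : ℝ≥0} (hθ : 0 < θ) :
    ∃ g : X → Z, ContDiff ℝ 1 g ∧ (∀ x ∈ B, ‖F x - g x‖ ≤ θ) ∧
      (∀ x, (∀ i η, 0 < η → x ∈ U i → G i η x = F x) → g x = F x) ∧
      (∀ x ∈ B, ∀ (T : X →L[ℝ] Z) (c : ℝ),
        (∀ i η, 0 < η → x ∈ U i → ‖fderiv ℝ (G i η) x - T‖ ≤ c) →
          ‖fderiv ℝ g x - T‖ ≤ c + θ) ∧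
      (∀ c : ℝ≥0, (∀ i η, 0 < η → LipschitzOnWith c (F - G i η) (U i ∩ B)) →
        LipschitzOnWith (c + θ) (F - g) B) := by
  -- The partition depends only on the cover, so the accuracies may now be chosen in terms of it.
  obtain ⟨P⟩ := nonempty_discretePartition hX hU hcov
  have hθ' : (0 : ℝ) < θ := NNReal.coe_pos.2 hθ
  have htol := P.tol_pos hθ'
  have hG' : ∀ n i, ContDiffOn ℝ 1 (G i (P.tol θ n)) (U i) := fun n i => hG i _ (htol n)
  have hv : ∀ n, ∀ x ∈ B, x ∈ U (P.index n x) →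
      ‖F x - G (P.index n x) (P.tol θ n) x‖ ≤ P.tol θ n :=
    fun n x hx hxU => hGF _ _ (htol n) x ⟨hxU, hx⟩
  refine ⟨P.glue fun n i => G i (P.tol θ n), DiscretePartition.contDiff_glue hU hG', ?_, ?_, ?_, ?_⟩
  · intro x hx
    rw [norm_sub_rev]
    refine DiscretePartition.norm_glue_sub_le fun n hn => ?_
    rw [norm_sub_rev]
    exact (hv n x hx hn).trans (P.tol_le hθ' n)
  · intro x h
    refine sub_eq_zero.1 (norm_le_zero_iff.1 (DiscretePartition.norm_glue_sub_le fun n hn => ?_))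
    rw [h _ _ (htol n) hn, sub_self, norm_zero]
  · intro x hx T c h
    refine DiscretePartition.norm_fderiv_glue_sub_le hU hG' hθ' (v := F x) (fun n hn => ?_)
      fun n hn => h _ _ (htol n) hn
    rw [norm_sub_rev]
    exact hv n x hx hn
  · intro c h
    exact DiscretePartition.lipschitzOnWith_sub_glue hθ hv fun n i => h i _ (htol n)

end Glue

/-! ### Bounded extension, and Lipschitz estimates on a union of balls -/

section Extension

variable {X Z : Type*} [NormedAddCommGroup X] [NormedAddCommGroup Z]

/-- A bounded Lipschitz map extends, under (E), to a bounded Lipschitz map. -/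
theorem PropertyE.exists_bounded_extension {K : ℝ≥0} (hE : PropertyE X Z K) {S : Set X}
    {φ : X → Z} {L : ℝ≥0} (hL : 0 < L) (hφ : LipschitzOnWith L φ S) {Q : ℝ} (hQ : 0 < Q)
    (hφQ : ∀ x ∈ S, ‖φ x‖ ≤ Q) :
    ∃ F : X → Z, LipschitzWith (K * L) F ∧ Set.EqOn F φ S ∧ ∀ x, ‖F x‖ ≤ (K + 1) * Q := by
  classical
  have hL' : (0 : ℝ) < L := NNReal.coe_pos.2 hL
  -- At distance at least Q / L from S the value 0 can be prescribed without raising the Lipschitz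
  -- constant. Every other point is within Q / L of S, where the extension exceeds Q by at most K L
  -- (Q / L).
  let T : Set X := {x | ∀ s ∈ S, Q / L ≤ dist x s}
  have hdisj : ∀ x ∈ T, x ∉ S := fun x hx hxS => by
    have h1 : Q / L ≤ dist x x := hx x hxS
    rw [dist_self] at h1
    exact absurd h1 (not_le.2 (by positivity))
  have hfar : ∀ s ∈ S, ∀ t ∈ T, ‖φ s‖ ≤ L * dist t s := fun s hs t ht => by
    refine (hφQ s hs).trans ?_
    have h1 : Q / L ≤ dist t s := ht s hs
    rwa [div_le_iff₀' hL'] at h1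
  have hind : LipschitzOnWith L (S.indicator φ) (S ∪ T) := by
    refine LipschitzOnWith.of_dist_le_mul ?_
    rintro x (hx | hx) y (hy | hy)
    · rw [Set.indicator_of_mem hx, Set.indicator_of_mem hy]
      exact hφ.dist_le_mul x hx y hy
    · rw [Set.indicator_of_mem hx, Set.indicator_of_notMem (hdisj y hy), dist_zero_right,
        dist_comm]
      exact hfar x hx y hy
    · rw [Set.indicator_of_notMem (hdisj x hx), Set.indicator_of_mem hy, dist_zero_left]
      exact hfar y hy x hx
    · rw [Set.indicator_of_notMem (hdisj x hx), Set.indicator_of_notMem (hdisj y hy), dist_self]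
      positivity
  obtain ⟨F, hF, hFeq⟩ := hE _ _ _ hind
  refine ⟨F, hF, fun x hx => ?_, fun x => ?_⟩
  · rw [hFeq (.inl hx), Set.indicator_of_mem hx]
  · by_cases hx : x ∈ T
    · rw [hFeq (.inr hx), Set.indicator_of_notMem (hdisj x hx), norm_zero]
      positivity
    · have hx' : ∃ s ∈ S, dist x s < Q / L := by
        by_contra! hcon
        exact hx hcon
      obtain ⟨s, hs, hxs⟩ := hx'
      have h1 := hF.dist_le_mul x s
      rw [dist_eq_norm, hFeq (.inl hs), Set.indicator_of_mem hs] at h1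
      have h2 : ‖F x‖ ≤ ‖F x - φ s‖ + ‖φ s‖ := by
        simpa using norm_add_le (F x - φ s) (φ s)
      have h3 : (↑(K * L) : ℝ) * dist x s ≤ K * Q := by
        push_cast
        rw [mul_assoc]
        have : L * dist x s ≤ Q := by
          rw [lt_div_iff₀' hL'] at hxs
          exact hxs.le
        gcongr
      linarith [hφQ s hs]

/-- If `g` is `N`-Lipschitz on balls around the points of `A` and `L`-Lipschitz on `A`, then it is
Lipschitz on the union of the balls shrunk by the factor `τ`. -/
theorem lipschitzOnWith_iUnion_ball {A : Set X} {g : X → Z} {r : X → ℝ}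
    {N L τ : ℝ} (hN : 0 ≤ N) (hL : 0 ≤ L) (hτ : 2 < τ)
    (hgN : ∀ y ∈ A, ∀ z ∈ Metric.ball y (r y), ∀ w ∈ Metric.ball y (r y),
      ‖g z - g w‖ ≤ N * dist z w)
    (hgL : ∀ y ∈ A, ∀ y' ∈ A, ‖g y - g y'‖ ≤ L * dist y y') {L' : ℝ≥0}
    (hL₁ : 2 * (2 / (τ - 2)) * N + L * (2 * (2 / (τ - 2)) + 1) ≤ L') (hL₂ : N ≤ L') :
    LipschitzOnWith L' g (⋃ y ∈ A, Metric.ball y (r y / τ)) := by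
  have hτ0 : 0 < τ := by linarith
  refine LipschitzOnWith.of_dist_le_mul fun z hz w hw => ?_
  simp only [Set.mem_iUnion, exists_prop] at hz hw
  obtain ⟨y, hy, hzy⟩ := hz
  obtain ⟨y', hy', hwy⟩ := hw
  wlog hrr : r y' ≤ r y generalizing z w y y'
  · rw [dist_comm, dist_comm z]
    exact this w z y' hy' hwy y hy hzy (le_of_not_ge hrr)
  have hry : 0 < r y := by
    have := dist_nonneg.trans_lt (Metric.mem_ball.1 hzy)
    exact (div_pos_iff_of_pos_right hτ0).1 this
  have hry' : 0 < r y' := by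
    have := dist_nonneg.trans_lt (Metric.mem_ball.1 hwy)
    exact (div_pos_iff_of_pos_right hτ0).1 this
  have hsub : ∀ {x}, 0 < r x → Metric.ball x (r x / τ) ⊆ Metric.ball x (r x) := fun h =>
    Metric.ball_subset_ball (div_le_self h.le (by linarith))
  rw [dist_eq_norm]
  by_cases hw' : w ∈ Metric.ball y (r y)
  · exact (hgN y hy z (hsub hry hzy) w hw').trans (by gcongr)
  have h1 : r y ≤ dist w y := by simpa using hw'
  have h2 := Metric.mem_ball.1 hzy
  have h3 := Metric.mem_ball.1 hwy
  set d := dist z w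
  have h4 : dist w y ≤ d + dist z y := by
    rw [show d = dist w z from dist_comm z w]
    exact dist_triangle w z y
  set q := r y / τ
  have hq : r y = τ * q := by simp only [q]; field_simp
  have h5 : r y' / τ ≤ q := by simp only [q]; gcongr
  -- Here w is at least τq from y and z is within q, so d > (τ - 1)q, which is more than enough.
  have hqd : 2 * q ≤ 2 * (2 / (τ - 2)) * d := by
    have h6 : 0 < τ - 2 := by linarith
    have h7 : 2 * (2 / (τ - 2)) * d = 4 * d / (τ - 2) := by ring
    rw [h7, le_div_iff₀ h6]
    have h8 : 0 < q := div_pos hry hτ0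
    nlinarith
  have hsum : dist z y + dist w y' ≤ 2 * (2 / (τ - 2)) * d := by linarith
  have hyy : dist y y' ≤ (2 * (2 / (τ - 2)) + 1) * d := by
    have := dist_triangle4 y z w y'
    rw [dist_comm y z] at this
    linarith
  have hz2 := hgN y hy z (hsub hry hzy) y (Metric.mem_ball_self hry)
  have hw2 := hgN y' hy' w (hsub hry' hwy) y' (Metric.mem_ball_self hry')
  have hy2 := hgL y hy y' hy'
  have htri : ‖g z - g w‖ ≤ ‖g z - g y‖ + ‖g y - g y'‖ + ‖g w - g y'‖ := by
    rw [← dist_eq_norm, ← dist_eq_norm, ← dist_eq_norm, ← dist_eq_norm, dist_comm (g w)]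
    exact dist_triangle4 _ _ _ _
  have h9 : N * dist z y + N * dist w y' ≤ 2 * (2 / (τ - 2)) * N * d := by
    rw [← mul_add]
    calc _ ≤ N * (2 * (2 / (τ - 2)) * d) := by gcongr
      _ = _ := by ring
  have h10 : L * dist y y' ≤ L * (2 * (2 / (τ - 2)) + 1) * d := by
    rw [mul_assoc]
    gcongr
  calc _ ≤ (2 * (2 / (τ - 2)) * N + L * (2 * (2 / (τ - 2)) + 1)) * d := by
        rw [add_mul]
        linarith
    _ ≤ L' * d := by gcongr

end Extension

/-! ### The two smoothing steps -/

section Approximation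

variable {X Z : Type*} [NormedAddCommGroup X] [NormedSpace ℝ X]
  [NormedAddCommGroup Z] [NormedSpace ℝ Z]

/-- A map satisfying the mean value condition on a closed set is approximated on that set, together
with its derivative and in the Lipschitz seminorm, by a global `C¹` map. -/
theorem MeanValueCondition.exists_contDiff_approximation {C : ℝ≥0} (hZ : PropertyStar X Z C)
    (hX : PropertyStar X ℝ C) {A : Set X} (hA : IsClosed A) {f : X → Z} {D : X → X →L[ℝ] Z}
    (hD : MeanValueCondition f D A) {κ : ℝ≥0} (hκ : 0 < κ) :
    ∃ g : X → Z, ContDiff ℝ 1 g ∧ (∀ y ∈ A, ‖f y - g y‖ ≤ κ) ∧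
      (∀ y ∈ A, ‖fderiv ℝ g y - D y‖ ≤ (2 + C) * κ) ∧
      LipschitzOnWith ((2 + C) * κ) (f - g) A := by
  have hκ' : (0 : ℝ) < κ := NNReal.coe_pos.2 hκ
  have hr : ∀ y : A, ∃ r : ℝ, 0 < r ∧
      LipschitzOnWith κ (fun x => f x - (f y + D y (x - y))) (A ∩ Metric.ball (y : X) r) ∧
      ∀ x ∈ A ∩ Metric.ball (y : X) r, ‖D y - D x‖ ≤ κ := by
    rintro ⟨y, hy⟩
    obtain ⟨r₁, hr₁, h₁⟩ := hD.approx y hy κ hκ'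
    obtain ⟨r₂, hr₂, h₂⟩ := Metric.continuousOn_iff.1 hD.continuousOn y hy κ hκ'
    refine ⟨min r₁ r₂, lt_min hr₁ hr₂, LipschitzOnWith.of_dist_le_mul fun z hz w hw => ?_,
      fun x hx => ?_⟩
    · rw [dist_eq_norm, dist_eq_norm]
      have : f z - (f y + D y (z - y)) - (f w - (f y + D y (w - y))) =
          f z - f w - D y (z - w) := by
        simp only [map_sub]
        abel
      rw [this]
      exact h₁ z ⟨hz.1, Metric.ball_subset_ball (min_le_left _ _) hz.2⟩
        w ⟨hw.1, Metric.ball_subset_ball (min_le_left _ _) hw.2⟩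
    · rw [← dist_eq_norm, dist_comm]
      exact (h₂ x hx.1 (Metric.ball_subset_ball (min_le_right _ _) hx.2)).le
  choose r hr0 hrL hrD using hr
  have hψ : ∀ (y : A) (η : ℝ), ∃ ψ : X → Z, ContDiff ℝ 1 ψ ∧ LipschitzWith (C * κ) ψ ∧
      (0 < η → ∀ x ∈ A ∩ Metric.ball (y : X) (r y),
        ‖f x - (f y + D y (x - y)) - ψ x‖ ≤ η) := by
    intro y η
    by_cases hη : 0 < η
    · obtain ⟨ψ, h1, h2, h3⟩ := hZ _ _ _ (hrL y) η hη
      exact ⟨ψ, h1, h2, fun _ x hx => (h3 x hx).le⟩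
    · exact ⟨0, contDiff_const, (LipschitzWith.const (0 : Z)).weaken zero_le,
        fun h => absurd h hη⟩
  choose ψ hψC hψL hψf using hψ
  -- The extra member Aᶜ completes the cover; nothing is required there, so its approximant is 0.
  let U : Option A → Set X := fun o => o.elim Aᶜ fun y => Metric.ball (y : X) (r y)
  let G : Option A → ℝ → X → Z :=
    fun o η => o.elim 0 fun y x => f y + D y (x - y) + ψ y η x
  have hU : ∀ o, IsOpen (U o) := by
    rintro (_ | y)
    · exact hA.isOpen_compl
    · exact Metric.isOpen_ball
  have hcov : ∀ x, ∃ o, x ∈ U o := fun x => by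
    by_cases hx : x ∈ A
    · exact ⟨some ⟨x, hx⟩, Metric.mem_ball_self (hr0 _)⟩
    · exact ⟨none, hx⟩
  have hTC : ∀ y : A, ContDiff ℝ 1 fun x => f y + D y (x - y) := fun y =>
    contDiff_const.add ((D y).contDiff.comp (contDiff_id.sub contDiff_const))
  have hGC : ∀ o η, 0 < η → ContDiffOn ℝ 1 (G o η) (U o) := by
    rintro (_ | y) η -
    · exact contDiffOn_const
    · exact ((hTC y).add (hψC y η)).contDiffOn
  have hGf : ∀ o η, 0 < η → ∀ x ∈ U o ∩ A, ‖f x - G o η x‖ ≤ η := by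
    rintro (_ | y) η hη x ⟨hxU, hxA⟩
    · exact absurd hxA hxU
    · have := hψf y η hη x ⟨hxA, hxU⟩
      rwa [sub_sub] at this
  obtain ⟨g, hg, hfg, -, hDg, hLg⟩ := exists_glued_approximation hX hU hcov A f G hGC hGf hκ
  refine ⟨g, hg, hfg, fun x hx => ?_, ?_⟩
  -- The constant 2 + C: κ from the oscillation of D, Cκ from the derivative of ψ, κ from gluing. In
  -- the Lipschitz estimate the first κ comes from the remainder instead.
  · refine (hDg x hx (D x) ((1 + C) * κ) ?_).trans_eq (by ring)
    rintro (_ | y) η hη hxU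
    · exact absurd hx hxU
    · have h1 : fderiv ℝ (G (some y) η) x = D y + fderiv ℝ (ψ y η) x := by
        have h2 : HasFDerivAt (fun x => f y + D y (x - y)) (D y) x := by
          have := ((D (y : X)).hasFDerivAt (x := x - y)).comp x
            ((hasFDerivAt_id x).sub_const (y : X))
          exact (this.const_add (f y))
        exact (h2.add ((hψC y η).contDiffAt.differentiableAt one_ne_zero).hasFDerivAt).fderiv
      rw [h1, add_sub_right_comm]
      refine (norm_add_le _ _).trans ?_
      rw [add_mul, one_mul]
      refine add_le_add (hrD y x ⟨hx, hxU⟩) ?_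
      exact_mod_cast norm_fderiv_le_of_lipschitz ℝ (hψL y η)
  · have := hLg ((1 + C) * κ) ?_
    · convert this using 1
      ring
    rintro (_ | y) η hη
    · rintro x ⟨hxU, hxA⟩
      exact absurd hxA hxU
    · have h1 := ((hrL y).mono (Set.inter_comm _ _).subset).sub
        ((hψL y η).lipschitzOnWith (s := Metric.ball (y : X) (r y) ∩ A))
      have h2 : f - G (some y) η = fun x => f x - (f y + D y (x - y)) - ψ y η x := by
        ext x
        simp only [Pi.sub_apply, G, Option.elim, sub_sub]
      rw [h2, add_mul, one_mul]
      exact h1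

/-- Under (*), a Lipschitz map which is already `C¹` on an open set `S` is uniformly close to a
`C¹` Lipschitz map that agrees with it, and almost agrees in derivative, on a closed `A ⊆ S`. -/
theorem exists_contDiff_of_contDiffOn {C : ℝ≥0} (hZ : PropertyStar X Z C)
    (hX : PropertyStar X ℝ C) {A S : Set X} (hA : IsClosed A) (hS : IsOpen S) (hAS : A ⊆ S)
    {F : X → Z} {L : ℝ≥0} (hF : LipschitzWith L F) (hFS : ContDiffOn ℝ 1 F S) {θ : ℝ≥0}
    (hθ : 0 < θ) :
    ∃ g : X → Z, ContDiff ℝ 1 g ∧ (∀ x, ‖F x - g x‖ ≤ θ) ∧ Set.EqOn g F A ∧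
      (∀ x ∈ A, ‖fderiv ℝ g x - fderiv ℝ F x‖ ≤ θ) ∧ LipschitzWith (C * L + θ) g := by
  have hψ : ∀ η : ℝ, ∃ ψ : X → Z, ContDiff ℝ 1 ψ ∧ LipschitzWith (C * L) ψ ∧
      (0 < η → ∀ x, ‖F x - ψ x‖ ≤ η) := by
    intro η
    by_cases hη : 0 < η
    · obtain ⟨ψ, h1, h2, h3⟩ := hZ Set.univ F L hF.lipschitzOnWith η hη
      exact ⟨ψ, h1, h2, fun _ x => (h3 x trivial).le⟩
    · exact ⟨0, contDiff_const, (LipschitzWith.const (0 : Z)).weaken zero_le,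
        fun h => absurd h hη⟩
  choose ψ hψC hψL hψF using hψ
  -- C ≥ 1 is not assumed; F inherits the constant C L as a uniform limit of the ψ η.
  have hFL : LipschitzWith (C * L) F := by
    refine LipschitzWith.of_dist_le_mul fun x y => le_of_forall_pos_le_add fun η hη => ?_
    have h1 := hψF (η / 2) (half_pos hη) x
    have h2 := hψF (η / 2) (half_pos hη) y
    rw [← dist_eq_norm] at h1 h2
    have h3 := (hψL (η / 2)).dist_le_mul x y
    have h4 := dist_triangle4 (F x) (ψ (η / 2) x) (ψ (η / 2) y) (F y)
    rw [dist_comm (ψ (η / 2) y)] at h4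
    linarith
  -- Points of A lie only in the member S, whose approximant is F itself; hence exact agreement on
  -- A.
  let U : Bool → Set X := fun b => if b then S else Aᶜ
  let G : Bool → ℝ → X → Z := fun b η => if b then F else ψ η
  have hU : ∀ b, IsOpen (U b) := by
    rintro (_ | _)
    · exact hA.isOpen_compl
    · exact hS
  have hcov : ∀ x, ∃ b, x ∈ U b := fun x => by
    by_cases hx : x ∈ A
    · exact ⟨true, hAS hx⟩
    · exact ⟨false, hx⟩
  have hGC : ∀ b η, 0 < η → ContDiffOn ℝ 1 (G b η) (U b) := by
    rintro (_ | _) η -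
    · exact (hψC η).contDiffOn
    · exact hFS
  have hGL : ∀ b η, LipschitzWith (C * L) (G b η) := by
    rintro (_ | _) η
    · exact hψL η
    · exact hFL
  have hGF : ∀ b η, 0 < η → ∀ x ∈ U b ∩ Set.univ, ‖F x - G b η x‖ ≤ η := by
    rintro (_ | _) η hη x -
    · exact hψF η hη x
    · simpa [G] using hη.le
  obtain ⟨g, hg, hFg, heq, hDg, -⟩ :=
    exists_glued_approximation hX hU hcov Set.univ F G hGC hGF hθ
  refine ⟨g, hg, fun x => hFg x trivial, fun x hx => heq x ?_, fun x hx => ?_, ?_⟩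
  · rintro (_ | _) η - hxU
    · exact absurd hx hxU
    · rfl
  · refine (hDg x trivial (fderiv ℝ F x) 0 ?_).trans_eq (zero_add _)
    rintro (_ | _) η - hxU
    · exact absurd hx hxU
    · simp [G]
  -- All approximants are C L-Lipschitz, so comparing derivatives with T = 0 bounds the derivative
  -- of g on all of X.
  · refine lipschitzWith_of_nnnorm_fderiv_le (𝕜 := ℝ) (hg.differentiable one_ne_zero) fun x => ?_
    have h := hDg x trivial 0 (C * L) fun b η _ _ => by
      rw [sub_zero]
      exact_mod_cast norm_fderiv_le_of_lipschitz ℝ (hGL b η)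
    rw [sub_zero] at h
    exact_mod_cast h

end Approximation

/-! ### A Lipschitz neighbourhood of A, and assembly -/

section Main

variable {X Z : Type*} [NormedAddCommGroup X] [NormedSpace ℝ X]
  [NormedAddCommGroup Z] [NormedSpace ℝ Z]

/-- A `C¹` map with controlled values, derivative and Lipschitz constant on `A` restricts, on some
open neighbourhood of `A`, to a Lipschitz map, bounded if it is bounded on `A`. -/
theorem exists_isOpen_lipschitzOnWith {A : Set X} {g : X → Z} (hg : ContDiff ℝ 1 g)
    {N L τ : ℝ} (hL : 0 ≤ L) (hτ : 2 < τ) (hgN : ∀ y ∈ A, ‖fderiv ℝ g y‖ < N)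
    (hgL : ∀ y ∈ A, ∀ y' ∈ A, ‖g y - g y'‖ ≤ L * dist y y') {L' : ℝ≥0}
    (hL₁ : 2 * (2 / (τ - 2)) * N + L * (2 * (2 / (τ - 2)) + 1) ≤ L') (hL₂ : N ≤ L')
    {p : Prop} {Q : ℝ} (hQ : p → ∀ y ∈ A, ‖g y‖ < Q) :
    ∃ S, IsOpen S ∧ A ⊆ S ∧ LipschitzOnWith L' g S ∧ (p → ∀ x ∈ S, ‖g x‖ ≤ Q) := by
  have hr : ∀ y, ∃ r : ℝ, 0 < r ∧ (y ∈ A → (∀ z ∈ Metric.ball y r, ‖fderiv ℝ g z‖ < N) ∧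
      (p → ∀ z ∈ Metric.ball y r, ‖g z‖ < Q)) := by
    intro y
    by_cases hy : y ∈ A
    · have h1 : ∀ᶠ z in 𝓝 y, ‖fderiv ℝ g z‖ < N :=
        (hg.continuous_fderiv one_ne_zero).norm.continuousAt.eventually_lt_const (hgN y hy)
      have h2 : ∀ᶠ z in 𝓝 y, p → ‖g z‖ < Q := by
        by_cases hp : p
        · exact (hg.continuous.norm.continuousAt.eventually_lt_const (hQ hp y hy)).mono
            fun z hz _ => hz
        · exact Eventually.of_forall fun z h => absurd h hp
      obtain ⟨r, hr, hball⟩ := Metric.eventually_nhds_iff_ball.1 (h1.and h2)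
      exact ⟨r, hr, fun _ => ⟨fun z hz => (hball z hz).1, fun hp z hz => (hball z hz).2 hp⟩⟩
    · exact ⟨1, one_pos, fun h => absurd h hy⟩
  choose r hr0 hr using hr
  have hτ0 : 0 < τ := by linarith
  refine ⟨⋃ y ∈ A, Metric.ball y (r y / τ), isOpen_biUnion fun y _ => Metric.isOpen_ball,
    fun y hy => Set.mem_biUnion hy (Metric.mem_ball_self (div_pos (hr0 y) hτ0)), ?_, ?_⟩
  -- N ≥ 0 is read off from a point of A.
  · rcases A.eq_empty_or_nonempty with rfl | ⟨a, ha⟩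
    · simp
    · refine lipschitzOnWith_iUnion_ball ((norm_nonneg _).trans (hgN a ha).le) hL hτ
        (fun y hy z hz w hw => ?_) hgL hL₁ hL₂
      rw [dist_eq_norm]
      exact (convex_ball y (r y)).norm_image_sub_le_of_norm_fderiv_le (𝕜 := ℝ)
        (fun x _ => hg.contDiffAt.differentiableAt one_ne_zero)
        (fun x hx => ((hr y hy).1 x hx).le) hw hz
  · intro hp x hx
    simp only [Set.mem_iUnion, exists_prop] at hx
    obtain ⟨y, hy, hxy⟩ := hx
    refine ((hr y hy).2 hp x (Metric.ball_subset_ball ?_ hxy)).le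
    exact div_le_self (hr0 y).le (by linarith)

theorem L₂_nonneg {C₀ ε' ℓ : ℝ} (hC : 0 ≤ C₀) (hε' : 0 ≤ ε') (hℓ : 0 ≤ ℓ) :
    0 ≤ L₂ C₀ ε' ℓ := by
  unfold L₂
  positivity

theorem L₃_pos {C₀ ε' ℓ M τ : ℝ} (hC : 0 ≤ C₀) (hε' : 0 < ε') (hM : 0 ≤ M) :
    0 < L₃ C₀ ε' ℓ M τ :=
  lt_max_of_lt_right (by positivity)

theorem L₄_nonneg {C₀ K ε' ℓ M τ : ℝ} (hC : 0 ≤ C₀) (hK : 0 ≤ K) (hε' : 0 < ε') (hM : 0 ≤ M) :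
    0 ≤ L₄ C₀ K ε' ℓ M τ := by
  have := L₃_pos (ℓ := ℓ) (τ := τ) hC hε' hM
  unfold L₄
  positivity

end Main

end SmoothExtension

open SmoothExtension in
theorem lemma3p8 {X Z : Type*} [NormedAddCommGroup X] [NormedSpace ℝ X] [CompleteSpace X]
    [NormedAddCommGroup Z] [NormedSpace ℝ Z] [CompleteSpace Z]
    (C₀ K : ℝ≥0) (hC₀ : 0 < C₀) (hK : 0 < K)
    (hStar : SmoothExtension.PropertyStar X Z C₀) (hE : SmoothExtension.PropertyE X Z K)
    (A : Set X) (hA : IsClosed A)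
    (f : X → Z) (D : X → X →L[ℝ] Z) (R : ℝ≥0∞) (hR : 0 < R) (M : ℝ) (hM : 0 ≤ M)
    (hf : SmoothExtension.IsLip f A) (hfR : ∀ y ∈ A, ‖f y‖ₑ ≤ R)
    (hD : SmoothExtension.MeanValueCondition f D A) (hDM : ∀ y ∈ A, ‖D y‖ ≤ M)
    (τ : ℝ) (hτ : 2 < τ) (ε ε' : ℝ) (hε' : 0 < ε') (hε : 3 * ε' < ε) :
    ∃ g : X → Z, ContDiff ℝ 1 g ∧
      (∀ y ∈ A, ‖f y - g y‖ < ε) ∧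
      (∀ y ∈ A, ‖D y - fderiv ℝ g y‖ < ε) ∧
      (SmoothExtension.IsLip (f - g) A ∧ (SmoothExtension.lip (f - g) A : ℝ) < ε) ∧
      (R ≠ ∞ → ∀ x, ‖g x‖ ≤ SmoothExtension.Q₁ C₀ K ε' R.toReal) ∧
      (SmoothExtension.IsLip g Set.univ ∧
        (SmoothExtension.lip g Set.univ : ℝ) ≤
          SmoothExtension.L₄ C₀ K ε' (SmoothExtension.lip f A) M τ) := by
  have hC : (0 : ℝ) < C₀ := NNReal.coe_pos.2 hC₀
  have hε0 : 0 < ε := by linarith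
  have hL₃ := L₃_pos (ℓ := lip f A) (τ := τ) hC.le hε' hM
  -- For Z = 0 property (*) says nothing about real-valued maps, so no partition is available; g = 0
  -- works directly.
  rcases subsingleton_or_nontrivial Z with hZ | hZ
  · have h0 : ∀ (h : X → Z) (B : Set X), LipschitzOnWith 0 h B := fun h B x _ y _ => by
      simp [Subsingleton.elim (h x) (h y)]
    have h1 : ∀ (h : X → Z) (B : Set X), (lip h B : ℝ) ≤ 0 := fun h B => by
      exact_mod_cast lip_le (h0 h B)
    refine ⟨0, contDiff_const, fun y _ => ?_, fun y _ => ?_,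
      ⟨⟨0, h0 _ A⟩, (h1 _ _).trans_lt hε0⟩, fun _ x => ?_,
      ⟨⟨0, h0 _ _⟩, (h1 _ _).trans (L₄_nonneg hC.le K.2 hε' hM)⟩⟩
    · rwa [Subsingleton.elim (f y - _) 0, norm_zero]
    · rwa [Subsingleton.elim (D y - _) 0, norm_zero]
    · simp only [Pi.zero_apply, norm_zero]
      unfold Q₁
      positivity
  -- The bound ε'/C₀ yields L₂ for g₁ on A; ε'/2 leaves room in the derivative estimate for the
  -- second smoothing.
  set σ : ℝ := min (ε' / 2) (ε' / C₀)
  have hσ : 0 < σ := lt_min (by positivity) (by positivity)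
  have hσ₁ : σ ≤ ε' / 2 := min_le_left _ _
  have hσ₂ : σ ≤ ε' / C₀ := min_le_right _ _
  obtain ⟨κ, hκ⟩ : ∃ κ : ℝ≥0, (κ : ℝ) = σ / (2 + C₀) := ⟨⟨σ / (2 + C₀), by positivity⟩, rfl⟩
  have hκ0 : 0 < κ := NNReal.coe_pos.1 (by rw [hκ]; positivity)
  have hκσ : (2 + (C₀ : ℝ)) * κ = σ := by rw [hκ]; field_simp
  have hκ1 : (κ : ℝ) ≤ σ := by
    rw [← hκσ]
    exact le_mul_of_one_le_left κ.2 (by linarith)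
  have hReal := hStar.real
  obtain ⟨g₁, hg₁, hfg, hDg, hLg⟩ := hD.exists_contDiff_approximation hStar hReal hA hκ0
  rw [hκσ] at hDg
  have hlipσ : (((2 + C₀) * κ : ℝ≥0) : ℝ) = σ := by exact_mod_cast hκσ
  have hg₁L : ∀ y ∈ A, ∀ y' ∈ A, ‖g₁ y - g₁ y'‖ ≤ L₂ C₀ ε' (lip f A) * dist y y' := by
    intro y hy y' hy'
    have h1 := hLg.dist_le_mul y hy y' hy'
    have h2 := hf.lipschitzOnWith_lip.dist_le_mul y hy y' hy'
    rw [hlipσ, dist_eq_norm] at h1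
    rw [dist_eq_norm] at h2
    have h3 : g₁ y - g₁ y' = f y - f y' - ((f - g₁) y - (f - g₁) y') := by
      simp only [Pi.sub_apply]
      abel
    rw [h3]
    refine (norm_sub_le _ _).trans ?_
    have h4 : σ * dist y y' ≤ ε' / C₀ * dist y y' := by gcongr
    rw [L₂, add_mul]
    linarith
  have hN : 0 < ε' / (8 * C₀) := by positivity
  -- Strictness, from the slack ε'/(8C₀) + ε' - σ > 0, lets the bound persist on a ball around y.
  have hg₁N : ∀ y ∈ A, ‖fderiv ℝ g₁ y‖ < ε' / (8 * C₀) + ε' + M := by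
    intro y hy
    have h1 : ‖fderiv ℝ g₁ y‖ ≤ ‖fderiv ℝ g₁ y - D y‖ + ‖D y‖ := by
      simpa using norm_add_le (fderiv ℝ g₁ y - D y) (D y)
    linarith [hDg y hy, hDM y hy]
  have hg₁R : R ≠ ∞ → ∀ y ∈ A, ‖g₁ y‖ < R.toReal + ε' + ε' / (8 * C₀) := by
    intro hRt y hy
    have h1 : ‖f y‖ ≤ R.toReal := by
      simpa using ENNReal.toReal_mono hRt (hfR y hy)
    have h2 : ‖g₁ y‖ ≤ ‖f y‖ + ‖f y - g₁ y‖ := by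
      simpa using norm_sub_le (f y) (f y - g₁ y)
    linarith [hfg y hy]
  obtain ⟨Λ, hΛ⟩ : ∃ Λ : ℝ≥0, (Λ : ℝ) = L₃ C₀ ε' (lip f A) M τ := ⟨⟨_, hL₃.le⟩, rfl⟩
  have hΛ0 : 0 < Λ := NNReal.coe_pos.1 (by rw [hΛ]; exact hL₃)
  obtain ⟨S, hSo, hAS, hgS, hRS⟩ := exists_isOpen_lipschitzOnWith hg₁
    (L₂_nonneg hC.le hε'.le (lip f A).2) hτ hg₁N hg₁L (L' := Λ)
    (by rw [hΛ]; exact le_max_left _ _) (by rw [hΛ]; exact le_max_right _ _) hg₁R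
  obtain ⟨F, hF, hFS, hFR⟩ : ∃ F : X → Z, LipschitzWith (K * Λ) F ∧ Set.EqOn F g₁ S ∧
      (R ≠ ∞ → ∀ x, ‖F x‖ ≤ (K + 1) * (R.toReal + ε' + ε' / (8 * C₀))) := by
    by_cases hRt : R = ∞
    · obtain ⟨F, h1, h2⟩ := hE S g₁ Λ hgS
      exact ⟨F, h1, h2, fun h => absurd hRt h⟩
    · obtain ⟨F, h1, h2, h3⟩ := hE.exists_bounded_extension hΛ0 hgS
        (by positivity : 0 < R.toReal + ε' + ε' / (8 * C₀)) (hRS hRt)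
      exact ⟨F, h1, h2, fun _ => h3⟩
  -- The value ε'/8 is the last term of Q₁, and fits in the ε'/4 of L₄.
  obtain ⟨θ, hθ⟩ : ∃ θ : ℝ≥0, (θ : ℝ) = ε' / 8 := ⟨⟨ε' / 8, by positivity⟩, rfl⟩
  have hθ0 : 0 < θ := NNReal.coe_pos.1 (by rw [hθ]; positivity)
  obtain ⟨g, hg, hFg, hgA, hDgF, hgL⟩ := exists_contDiff_of_contDiffOn hStar hReal hA hSo hAS hF
    (hg₁.contDiffOn.congr hFS) hθ0
  rw [hθ] at hFg hDgF
  -- As g = g₁ on A, the value and Lipschitz estimates for f - g₁ pass to f - g unchanged; only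
  -- derivatives incur a second error.
  have hgg₁ : Set.EqOn g g₁ A := fun x hx => (hgA hx).trans (hFS (hAS hx))
  have hLfg : LipschitzOnWith ((2 + C₀) * κ) (f - g) A :=
    fun x hx y hy => by simpa [hgg₁ hx, hgg₁ hy] using hLg hx hy
  refine ⟨g, hg, fun y hy => ?_, fun y hy => ?_, ⟨⟨_, hLfg⟩, ?_⟩, fun hRt x => ?_,
    ⟨⟨_, hgL.lipschitzOnWith⟩, ?_⟩⟩
  · rw [hgg₁ hy]
    linarith [hfg y hy]
  · have h1 : fderiv ℝ F y = fderiv ℝ g₁ y :=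
      (hFS.eventuallyEq_of_mem (hSo.mem_nhds (hAS hy))).fderiv_eq
    have h2 := hDgF y hy
    have h3 := hDg y hy
    rw [h1] at h2
    rw [norm_sub_rev]
    have h4 := norm_sub_le_norm_sub_add_norm_sub (fderiv ℝ g y) (fderiv ℝ g₁ y) (D y)
    linarith
  · have h1 : (lip (f - g) A : ℝ) ≤ σ := by
      rw [← hlipσ]
      exact_mod_cast lip_le hLfg
    linarith
  · have h1 : ‖g x‖ ≤ ‖F x‖ + ‖F x - g x‖ := by
      simpa using norm_sub_le (F x) (F x - g x)
    rw [Q₁]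
    linarith [hFg x, hFR hRt x]
  · have h1 : (lip g Set.univ : ℝ) ≤ C₀ * (K * Λ) + θ := by
      exact_mod_cast lip_le hgL.lipschitzOnWith
    rw [hθ, hΛ, ← mul_assoc] at h1
    rw [L₄]
    linarith
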